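/- Let $n\ge 1$ and let $(M,P,g)$ be a Riemannian almost product manifold of dimension $2n$: $M$ is a smooth manifold, $g$ a Riemannian metric and $P$ a smooth $(1,1)$-tensor field with $P^2=\mathrm{id}$, $g(Px,Py)=g(x,y)$, and assume $\operatorname{tr}P=0$. Let $\nabla$ be the Levi-Civita connection of $g$, $F(x,y,z)=g((\nabla_xP)y,z)$, $\theta(z)=g^{ij}F(e_i,e_j,z)$, and let $\Omega$ be the vector field with $g(\Omega,x)=\theta(x)$. Assume that $(M,P,g)$ belongs to the class $\mathcal W_1$, that is, $$F(x,y,z)=\tfrac1{2n}\{g(x,y)\theta(z)-g(x,Py)\theta(Pz)+g(x,z)\theta(y)-g(x,Pz)\theta(Py)\}.$$ Let $\lambda,\mu\in\mathbb R$ and let $\nabla'$ be the natural connection (a linear connection with $\nabla'P=\nabla'g=0$) with parameters $(\lambda,\mu)$, i.e. the one whose torsion $T(x,y,z)=g(T(x,y),z)$ is $$\begin{aligned}T(x,y,z)={}&\tfrac1{2n}\{g(y,z)\theta(Px)-g(x,z)\theta(Py)\}\\&+\lambda\{g(y,z)\theta(x)-g(x,z)\theta(y)+g(y,Pz)\theta(Px)-g(x,Pz)\theta(Py)\}\\&+\mu\{g(y,Pz)\theta(x)-g(x,Pz)\theta(y)+g(y,z)\theta(Px)-g(x,z)\theta(Py)\}.\end{aligned}$$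 Put $$p=\lambda\Omega+(\mu+\tfrac1{2n})P\Omega,\qquad q=\lambda P\Omega+\mu\Omega,$$ $$U(x,w)=\lambda(\nabla'_x\theta)w+(\mu+\tfrac1{2n})(\nabla'_x\theta)Pw,\qquad V(x,w)=\lambda(\nabla'_x\theta)Pw+\mu(\nabla'_x\theta)w,$$ $$S'(y,z)=U(y,z)-\tfrac1{2n}\{\lambda\theta(y)\theta(Pz)+\mu\theta(y)\theta(z)\},$$ $$S''(y,z)=V(y,Pz)+\tfrac1{2n}\{\lambda\theta(Py)\theta(z)+\mu\theta(Py)\theta(Pz)\},\qquad \widetilde{S''}(y,z)=S''(y,Pz).$$ For a connection with curvature $R(x,y)z=\nabla_x\nabla_yz-\nabla_y\nabla_xz-\nabla_{[x,y]}z$ let $\rho(y,z)=g^{ij}g(R(e_i,y)z,e_j)$ and $\tau=g^{ij}\rho(e_i,e_j)$; write $\rho,\tau$ for those of $\nabla$ and $\rho',\tau'$ for those of $\nabla'$. Traces of $(0,2)$-tensors are taken with respect to $g$. Then, at every point and for all tangent vectors $y,z$, $$\begin{aligned}\rho(y,z)={}&\rho'(y,z)-\{(2n-1)g(p,p)+\operatorname{tr}S'-g(q,q)\}g(y,z)\\&-\{\operatorname{tr}\widetilde{S''}+2(n-1)g(p,q)\}g(y,Pz)-2(n-1)S'(y,z)+S''(y,z)+S''(Py,Pz),\\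 \tau={}&\tau'-2n(2n-1)g(p,p)+2n\,g(q,q)-2(2n-1)\operatorname{tr}S'+2\operatorname{tr}S''.\end{aligned}$$ -/

import Mathlib

open Bundle Manifold
open scoped ContDiff

noncomputable section

namespace RiemannianProduct

/-- Linear connections on a smooth manifold `M`, as covariant derivatives on its tangent bundle:
`D Y a u` is the vector `(∇_u Y)(a)`. -/
abbrev Connection (E : Type*) [NormedAddCommGroup E] [NormedSpace ℝ E]
    (M : Type*) [TopologicalSpace M] [ChartedSpace E M] [IsManifold 𝓘(ℝ, E) ∞ M] :=
  CovariantDerivative 𝓘(ℝ, E) E (fun a : M ↦ TangentSpace 𝓘(ℝ, E) a)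

variable {E : Type*} [NormedAddCommGroup E] [NormedSpace ℝ E] [FiniteDimensional ℝ E]
  {M : Type*} [TopologicalSpace M] [ChartedSpace E M] [IsManifold 𝓘(ℝ, E) ∞ M]

instance (a : M) : FiniteDimensional ℝ (TangentSpace 𝓘(ℝ, E) a) :=
  inferInstanceAs (FiniteDimensional ℝ E)

/-- The vector field extending the tangent vector `u` at `a` by a field that is constant in the
preferred trivialization of the tangent bundle at `a`; it is smooth near `a`. The tensors below
are evaluated at tangent vectors by means of such extensions, and do not depend on this choice. -/
abbrev extField {a : M} (u : TangentSpace 𝓘(ℝ, E) a) : Π b : M, TangentSpace 𝓘(ℝ, E) b :=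
  FiberBundle.extend E u

/-- The value at `u, v, w` of the curvature tensor
`R(X, Y) Z = ∇_X ∇_Y Z - ∇_Y ∇_X Z - ∇_[X, Y] Z` of a linear connection. -/
def curvature (D : Connection E M) (a : M) (u v w : TangentSpace 𝓘(ℝ, E) a) :
    TangentSpace 𝓘(ℝ, E) a :=
  D (fun b ↦ D (extField w) b (extField v b)) a u - D (fun b ↦ D (extField w) b (extField u b)) a v
    - D (extField w) a (VectorField.mlieBracket 𝓘(ℝ, E) (extField u) (extField v) a)

/-- The covariant derivative `(∇_u P) v` of a field `P` of endomorphisms,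
`(∇_X P) Y = ∇_X (P Y) - P (∇_X Y)`. -/
def covDerivEnd (D : Connection E M)
    (P : Π a : M, TangentSpace 𝓘(ℝ, E) a →L[ℝ] TangentSpace 𝓘(ℝ, E) a)
    (a : M) (u v : TangentSpace 𝓘(ℝ, E) a) : TangentSpace 𝓘(ℝ, E) a :=
  D (fun b ↦ P b (extField v b)) a u - P a (D (extField v) a u)

/-- The covariant derivative `(∇_u η) v` of a 1-form `η`,
`(∇_X η) Y = X (η Y) - η (∇_X Y)`. -/
def covDerivForm (D : Connection E M) (η : Π a : M, TangentSpace 𝓘(ℝ, E) a → ℝ)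
    (a : M) (u v : TangentSpace 𝓘(ℝ, E) a) : ℝ :=
  mvfderiv 𝓘(ℝ, E) (fun b ↦ η b (extField v b)) a u - η a (D (extField v) a u)

variable [RiemannianBundle (fun a : M ↦ TangentSpace 𝓘(ℝ, E) a)]

/-- The trace `g^{ij} B(e_i, e_j)` of a bilinear form on a tangent space with respect to the
metric, computed in an orthonormal basis. -/
def metricTrace (a : M) (B : TangentSpace 𝓘(ℝ, E) a → TangentSpace 𝓘(ℝ, E) a → ℝ) : ℝ :=
  ∑ i, B (stdOrthonormalBasis ℝ (TangentSpace 𝓘(ℝ, E) a) i)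
    (stdOrthonormalBasis ℝ (TangentSpace 𝓘(ℝ, E) a) i)

/-- The Ricci tensor `ρ(y, z) = g^{ij} g(R(e_i, y) z, e_j)` of a linear connection. -/
def ricci (D : Connection E M) (a : M) (y z : TangentSpace 𝓘(ℝ, E) a) : ℝ :=
  metricTrace a fun u w ↦ inner ℝ (curvature D a u y z) w

/-- The scalar curvature `τ = g^{ij} ρ(e_i, e_j)` of a linear connection. -/
def scalarCurvature (D : Connection E M) (a : M) : ℝ :=
  metricTrace a (ricci D a)

/-- The connection is metric: `∇g = 0`, i.e.
`X g(Y, Z) = g(∇_X Y, Z) + g(Y, ∇_X Z)`. -/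
def IsMetric (D : Connection E M) : Prop :=
  ∀ (a : M) (Y Z : Π b : M, TangentSpace 𝓘(ℝ, E) b) (u : TangentSpace 𝓘(ℝ, E) a),
    MDiffAt (T% Y) a → MDiffAt (T% Z) a →
      mvfderiv 𝓘(ℝ, E) (fun b ↦ inner ℝ (Y b) (Z b)) a u
        = inner ℝ (D Y a u) (Z a) + inner ℝ (Y a) (D Z a u)

/-- The Levi-Civita connection: smooth, torsion-free and metric. -/
structure IsLeviCivita (D : Connection E M) : Prop where
  smooth : CovariantDerivative.ContMDiffCovariantDerivative D ∞
  torsion_eq_zero : D.torsion = 0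
  metric : IsMetric D

/-- `(M, P, g)` is a Riemannian almost product manifold: `P` is a smooth field of endomorphisms
with `P² = id` and `g(Px, Py) = g(x, y)`. -/
structure IsAlmostProduct
    (P : Π a : M, TangentSpace 𝓘(ℝ, E) a →L[ℝ] TangentSpace 𝓘(ℝ, E) a) : Prop where
  smooth : ContMDiff 𝓘(ℝ, E) (𝓘(ℝ, E).prod 𝓘(ℝ, E →L[ℝ] E)) ∞
    (fun a ↦ TotalSpace.mk' (E →L[ℝ] E)
      (E := fun b : M ↦ TangentSpace 𝓘(ℝ, E) b →L[ℝ] TangentSpace 𝓘(ℝ, E) b) a (P a))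
  sq : ∀ (a : M) (u : TangentSpace 𝓘(ℝ, E) a), P a (P a u) = u
  isometry : ∀ (a : M) (u v : TangentSpace 𝓘(ℝ, E) a),
    inner ℝ (P a u) (P a v) = inner ℝ u v

/-- A natural connection on `(M, P, g)`: a smooth linear connection with `∇'P = 0`, `∇'g = 0`. -/
structure IsNatural (D' : Connection E M)
    (P : Π a : M, TangentSpace 𝓘(ℝ, E) a →L[ℝ] TangentSpace 𝓘(ℝ, E) a) : Prop where
  smooth : CovariantDerivative.ContMDiffCovariantDerivative D' ∞
  metric : IsMetric D'
  parallel : ∀ (a : M) (u v : TangentSpace 𝓘(ℝ, E) a), covDerivEnd D' P a u v = 0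

section Tensors

variable (D : Connection E M)
  (P : Π a : M, TangentSpace 𝓘(ℝ, E) a →L[ℝ] TangentSpace 𝓘(ℝ, E) a)

/-- The tensor `F(x, y, z) = g((∇_x P) y, z)`. -/
def tensorF (a : M) (x y z : TangentSpace 𝓘(ℝ, E) a) : ℝ :=
  inner ℝ (covDerivEnd D P a x y) z

/-- The associated 1-form `θ(z) = g^{ij} F(e_i, e_j, z)`. -/
def theta (a : M) (z : TangentSpace 𝓘(ℝ, E) a) : ℝ :=
  metricTrace a fun x y ↦ tensorF D P a x y z

/-- The vector field `Ω` with `g(Ω, x) = θ(x)`, that is `Ω = ∑ θ(e_i) e_i` in an orthonormal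
basis. -/
def omega (a : M) : TangentSpace 𝓘(ℝ, E) a :=
  ∑ i, theta D P a (stdOrthonormalBasis ℝ (TangentSpace 𝓘(ℝ, E) a) i) •
    stdOrthonormalBasis ℝ (TangentSpace 𝓘(ℝ, E) a) i

/-- The class `𝒲₁`, for `dim M = 2n`. -/
def IsW1 (n : ℕ) : Prop :=
  ∀ (a : M) (x y z : TangentSpace 𝓘(ℝ, E) a),
    tensorF D P a x y z = 1 / (2 * n : ℝ) *
      (inner ℝ x y * theta D P a z - inner ℝ x (P a y) * theta D P a (P a z)
        + inner ℝ x z * theta D P a y - inner ℝ x (P a z) * theta D P a (P a y))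

/-- The torsion `T(x, y, z) = g(T(x, y), z)` of `D'` is the one with parameters `l`, `m`. -/
def HasTorsion (n : ℕ) (D' : Connection E M) (l m : ℝ) : Prop :=
  ∀ (a : M) (x y z : TangentSpace 𝓘(ℝ, E) a),
    inner ℝ (D'.torsion a x y) z =
      1 / (2 * n : ℝ) *
        (inner ℝ y z * theta D P a (P a x) - inner ℝ x z * theta D P a (P a y))
      + l * (inner ℝ y z * theta D P a x - inner ℝ x z * theta D P a y
        + inner ℝ y (P a z) * theta D P a (P a x) - inner ℝ x (P a z) * theta D P a (P a y))
      + m * (inner ℝ y (P a z) * theta D P a x - inner ℝ x (P a z) * theta D P a y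
        + inner ℝ y z * theta D P a (P a x) - inner ℝ x z * theta D P a (P a y))

/-- The vector field `p = λ Ω + (μ + 1/(2n)) P Ω`. -/
def fieldP (n : ℕ) (l m : ℝ) (a : M) : TangentSpace 𝓘(ℝ, E) a :=
  l • omega D P a + (m + 1 / (2 * n : ℝ)) • P a (omega D P a)

/-- The vector field `q = λ P Ω + μ Ω`. -/
def fieldQ (l m : ℝ) (a : M) : TangentSpace 𝓘(ℝ, E) a :=
  l • P a (omega D P a) + m • omega D P a

/-- The tensor `U(x, w) = λ (∇'_x θ) w + (μ + 1/(2n)) (∇'_x θ) Pw`. -/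
def tensorU (n : ℕ) (D' : Connection E M) (l m : ℝ) (a : M)
    (x w : TangentSpace 𝓘(ℝ, E) a) : ℝ :=
  l * covDerivForm D' (theta D P) a x w
    + (m + 1 / (2 * n : ℝ)) * covDerivForm D' (theta D P) a x (P a w)

/-- The tensor `V(x, w) = λ (∇'_x θ) Pw + μ (∇'_x θ) w`. -/
def tensorV (D' : Connection E M) (l m : ℝ) (a : M) (x w : TangentSpace 𝓘(ℝ, E) a) : ℝ :=
  l * covDerivForm D' (theta D P) a x (P a w) + m * covDerivForm D' (theta D P) a x w

/-- The tensor `S'(y, z) = U(y, z) - (1/(2n)) (λ θ(y) θ(Pz) + μ θ(y) θ(z))`. -/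
def tensorS₁ (n : ℕ) (D' : Connection E M) (l m : ℝ) (a : M)
    (y z : TangentSpace 𝓘(ℝ, E) a) : ℝ :=
  tensorU D P n D' l m a y z - 1 / (2 * n : ℝ) *
    (l * theta D P a y * theta D P a (P a z) + m * theta D P a y * theta D P a z)

/-- The tensor `S''(y, z) = V(y, Pz) + (1/(2n)) (λ θ(Py) θ(z) + μ θ(Py) θ(Pz))`. -/
def tensorS₂ (n : ℕ) (D' : Connection E M) (l m : ℝ) (a : M)
    (y z : TangentSpace 𝓘(ℝ, E) a) : ℝ :=
  tensorV D P D' l m a y (P a z) + 1 / (2 * n : ℝ) *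
    (l * theta D P a (P a y) * theta D P a z + m * theta D P a (P a y) * theta D P a (P a z))

end Tensors

end RiemannianProduct

end

/-! A metric connection is determined by its torsion. Reading the torsion as T(x,y) = g(p,x)y -
g(p,y)x + g(q,x)Py - g(q,y)Px, one finds ∇' = ∇ + Q with Q(x,y) = g(x,y)p - g(p,y)x + g(x,Py)q -
g(q,y)Px (`connection_eq_add_distortion`).

Since ∇'g = ∇'P = 0, differentiating Q by ∇' only differentiates p and q
(`IsNatural.connection_distortion`). Substituting ∇ = ∇' - Q into the curvature of ∇ gives R(u,v)w =
R'(u,v)w - (∇'_u Q)(v,w) + (∇'_v Q)(u,w) - Q(T(u,v),w) + Q(u,Q(v,w)) - Q(v,Q(u,w)) (`curvature_eq`).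
Contracting with tr P = 0 and dim M = 2n is linear algebra in one tangent space
(`sum_inner_curvature_difference`). The terms quadratic in p and q assemble into S' and S'' because
g(p,Py) - g(q,y) = θ(y)/(2n). A second contraction gives τ.

The argument needs p and q to be differentiable, while Ω is defined pointwise through orthonormal
bases chosen without regard to smoothness. The class 𝒲₁ supplies this: it expresses Ω by ∇P
evaluated on smooth local eigenfields of P (`IsW1.omega_eq`, `mdifferentiableAt_omega`). -/

set_option linter.unusedSectionVars false

noncomputable section

namespace RiemannianProduct

open Filter Topology

/-! ### Calculus of connections, and independence of the chosen extensions -/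

section Connections

variable {E : Type*} [NormedAddCommGroup E] [NormedSpace ℝ E]
  {M : Type*} [TopologicalSpace M] [ChartedSpace E M] [IsManifold 𝓘(ℝ, E) ∞ M]
  {a : M} {X Y Z W : Π b : M, TangentSpace 𝓘(ℝ, E) b}
  {P : Π b : M, TangentSpace 𝓘(ℝ, E) b →L[ℝ] TangentSpace 𝓘(ℝ, E) b}

/-- Smoothness of a field of endomorphisms of the tangent bundle. -/
abbrev IsSmoothEnd (P : Π b : M, TangentSpace 𝓘(ℝ, E) b →L[ℝ] TangentSpace 𝓘(ℝ, E) b) : Prop :=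
  ContMDiff 𝓘(ℝ, E) (𝓘(ℝ, E).prod 𝓘(ℝ, E →L[ℝ] E)) ∞
    (fun a ↦ TotalSpace.mk' (E →L[ℝ] E)
      (E := fun b : M ↦ TangentSpace 𝓘(ℝ, E) b →L[ℝ] TangentSpace 𝓘(ℝ, E) b) a (P a))

theorem mdifferentiableAt_extField (u : TangentSpace 𝓘(ℝ, E) a) :
    MDiffAt (T% (extField u)) a :=
  FiberBundle.mdifferentiableAt_extend ..

theorem MDifferentiableAt.end_apply (hP : IsSmoothEnd P) (hY : MDiffAt (T% Y) a) :
    MDiffAt (T% fun b ↦ P b (Y b)) a :=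
  MDifferentiableAt.clm_bundle_apply ((hP a).mdifferentiableAt (by simp)) hY

theorem ContMDiff.end_apply (hP : IsSmoothEnd P) (hY : CMDiff ∞ (T% Y)) :
    CMDiff ∞ (T% fun b ↦ P b (Y b)) :=
  ContMDiff.clm_bundle_apply hP hY

variable {D D' : Connection E M}

theorem contMDiff_connection_apply (hD : CovariantDerivative.ContMDiffCovariantDerivative D ∞)
    (hW : CMDiff ∞ (T% W)) (hY : CMDiff ∞ (T% Y)) :
    CMDiff ∞ (T% fun b ↦ D W b (Y b)) := by
  have h := hD.contMDiff.contMDiff (σ := W) (hW.contMDiffOn (s := Set.univ))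
  exact ContMDiff.clm_bundle_apply (contMDiffOn_univ.1 h) hY

theorem connection_add (hX : MDiffAt (T% X) a) (hY : MDiffAt (T% Y) a)
    (u : TangentSpace 𝓘(ℝ, E) a) :
    D (fun b ↦ X b + Y b) a u = D X a u + D Y a u := by
  have := D.isCovariantDerivativeOnUniv.add hX hY
  exact congrArg (fun L : TangentSpace 𝓘(ℝ, E) a →L[ℝ] TangentSpace 𝓘(ℝ, E) a ↦ L u) this

theorem connection_smul {f : M → ℝ} (hf : MDiffAt f a) (hX : MDiffAt (T% X) a)
    (u : TangentSpace 𝓘(ℝ, E) a) :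
    D (fun b ↦ f b • X b) a u = f a • D X a u + mvfderiv 𝓘(ℝ, E) f a u • X a := by
  have := D.isCovariantDerivativeOnUniv.leibniz hX hf
  exact congrArg (fun L : TangentSpace 𝓘(ℝ, E) a →L[ℝ] TangentSpace 𝓘(ℝ, E) a ↦ L u) this

theorem connection_const_smul (c : ℝ) (hX : MDiffAt (T% X) a) (u : TangentSpace 𝓘(ℝ, E) a) :
    D (fun b ↦ c • X b) a u = c • D X a u := by
  have := D.isCovariantDerivativeOnUniv.smul_const c hX
  exact congrArg (fun L : TangentSpace 𝓘(ℝ, E) a →L[ℝ] TangentSpace 𝓘(ℝ, E) a ↦ L u) this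

theorem MDifferentiableAt.fun_add_section (hX : MDiffAt (T% X) a) (hY : MDiffAt (T% Y) a) :
    MDiffAt (T% fun b ↦ X b + Y b) a :=
  mdifferentiableAt_add_section hX hY

theorem MDifferentiableAt.fun_sub_section (hX : MDiffAt (T% X) a) (hY : MDiffAt (T% Y) a) :
    MDiffAt (T% fun b ↦ X b - Y b) a :=
  mdifferentiableAt_sub_section hX hY

theorem MDifferentiableAt.fun_smul_section {f : M → ℝ} (hf : MDiffAt f a)
    (hX : MDiffAt (T% X) a) : MDiffAt (T% fun b ↦ f b • X b) a :=
  hf.smul_section hX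

theorem MDifferentiableAt.const_smul_section (c : ℝ) (hX : MDiffAt (T% X) a) :
    MDiffAt (T% fun b ↦ c • X b) a :=
  MDifferentiableAt.fun_smul_section (f := fun _ ↦ c) mdifferentiableAt_const hX

theorem connection_sub (hX : MDiffAt (T% X) a) (hY : MDiffAt (T% Y) a)
    (u : TangentSpace 𝓘(ℝ, E) a) :
    D (fun b ↦ X b - Y b) a u = D X a u - D Y a u := by
  have h := connection_add (D := D) hX (MDifferentiableAt.const_smul_section (-1) hY) u
  rw [connection_const_smul _ hY] at h
  simpa [sub_eq_add_neg] using h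

theorem connection_congr (hX : MDiffAt (T% X) a) (hY : MDiffAt (T% Y) a)
    (h : ∀ᶠ b in 𝓝 a, X b = Y b) : D X a = D Y a :=
  D.isCovariantDerivativeOnUniv.congr_of_eventuallyEq hX hY univ_mem h

variable [FiniteDimensional ℝ E]

/-- Every tangent vector extends to a globally smooth field with the germ of `extField`. -/
theorem exists_contMDiff_eventuallyEq_extField [T2Space M] (u : TangentSpace 𝓘(ℝ, E) a) :
    ∃ Y : Π b : M, TangentSpace 𝓘(ℝ, E) b,
      CMDiff ∞ (T% Y) ∧ ∀ᶠ b in 𝓝 a, Y b = extField u b := by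
  obtain ⟨s, hs, hsm⟩ := FiberBundle.exists_contMDiffOn_extend (k := ∞) 𝓘(ℝ, E) E u
  -- A bump function supported where the local extension is smooth makes the product globally smooth
  -- and leaves the germ at `a` unchanged.
  obtain ⟨f, hf⟩ := ((SmoothBumpFunction.nhds_basis_tsupport (I := 𝓘(ℝ, E)) a).mem_iff).1
    (interior_mem_nhds.2 hs)
  refine ⟨(f : M → ℝ) • extField u, ?_, ?_⟩
  · exact ContMDiffOn.smul_section_of_tsupport f.contMDiff.contMDiffOn isOpen_interior hf.2
      (hsm.mono interior_subset)
  · filter_upwards [f.eventuallyEq_one] with b hb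
    simp [hb]

/-- The covariant derivative of a field of endomorphisms is computed by any differentiable
extension of its argument. -/
theorem covDerivEnd_apply (hP : IsSmoothEnd P) (hY : MDiffAt (T% Y) a)
    (u : TangentSpace 𝓘(ℝ, E) a) :
    covDerivEnd D P a u (Y a) = D (fun b ↦ P b (Y b)) a u - P a (D Y a u) := by
  have hten : TensorialAt 𝓘(ℝ, E) E
      (fun Y : Π b : M, TangentSpace 𝓘(ℝ, E) b ↦ D (fun b ↦ P b (Y b)) a u - P a (D Y a u)) a := by
    constructor
    · intro f σ hf hσ
      have h1 := connection_smul (D := D) hf (MDifferentiableAt.end_apply hP hσ) u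
      have h2 := connection_smul (D := D) hf hσ u
      have h3 : (fun b ↦ P b ((f • σ) b)) = fun b ↦ f b • P b (σ b) := by
        ext b; simp
      rw [h3, h1]
      change _ - P a (D (fun b ↦ f b • σ b) a u) = _
      rw [h2]
      simp only [map_add, map_smul, smul_sub]
      abel
    · intro σ σ' hσ hσ'
      have h1 := connection_add (D := D) (MDifferentiableAt.end_apply hP hσ)
        (MDifferentiableAt.end_apply hP hσ') u
      have h2 := connection_add (D := D) hσ hσ' u
      have h3 : (fun b ↦ P b ((σ + σ') b)) = fun b ↦ P b (σ b) + P b (σ' b) := by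
        ext b; simp
      rw [h3, h1]
      change _ - P a (D (fun b ↦ σ b + σ' b) a u) = _
      rw [h2]
      simp only [map_add]
      abel
  exact hten.pointwise (mdifferentiableAt_extField _) hY (by simp)

/-- The curvature is computed by any smooth extensions with the germs of the canonical ones. -/
theorem curvature_eq_of_eventuallyEq (hD : CovariantDerivative.ContMDiffCovariantDerivative D ∞)
    (u v w : TangentSpace 𝓘(ℝ, E) a)
    (hX : CMDiff ∞ (T% X)) (hY : CMDiff ∞ (T% Y)) (hZ : CMDiff ∞ (T% Z))
    (hXu : ∀ᶠ b in 𝓝 a, X b = extField u b) (hYv : ∀ᶠ b in 𝓝 a, Y b = extField v b)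
    (hZw : ∀ᶠ b in 𝓝 a, Z b = extField w b) :
    curvature D a u v w = D (fun b ↦ D Z b (Y b)) a u - D (fun b ↦ D Z b (X b)) a v
      - D Z a (VectorField.mlieBracket 𝓘(ℝ, E) X Y a) := by
  have hD1 : ∀ᶠ b in 𝓝 a, D (extField w) b = D Z b := by
    filter_upwards [hZw.eventually_nhds] with b hb
    refine connection_congr ?_ (hZ b |>.mdifferentiableAt (by simp)) (hb.mono fun _ h ↦ h.symm)
    refine (hZ b |>.mdifferentiableAt (by simp)).congr_of_eventuallyEq ?_
    filter_upwards [hb] with c hc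
    simp [hc]
  -- For the outer derivative, agreement of the inner fields at `a` is not enough: they must agree
  -- near `a`, which is why `hD1` is an eventual equality.
  have key : ∀ {V : Π b : M, TangentSpace 𝓘(ℝ, E) b} (v : TangentSpace 𝓘(ℝ, E) a),
      CMDiff ∞ (T% V) → (∀ᶠ b in 𝓝 a, V b = extField v b) →
      D (fun b ↦ D (extField w) b (extField v b)) a = D (fun b ↦ D Z b (V b)) a := by
    intro V v hV hVv
    have hs := (contMDiff_connection_apply hD hZ hV a).mdifferentiableAt (by simp)
    have he : ∀ᶠ b in 𝓝 a, D (extField w) b (extField v b) = D Z b (V b) := by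
      filter_upwards [hD1, hVv] with b h1 h2
      rw [h1, h2]
    refine connection_congr (hs.congr_of_eventuallyEq ?_) hs he
    filter_upwards [he] with c hc
    simp [hc]
  have hb : VectorField.mlieBracket 𝓘(ℝ, E) (extField u) (extField v) a
      = VectorField.mlieBracket 𝓘(ℝ, E) X Y a :=
    Filter.EventuallyEq.mlieBracket_vectorField_eq (hXu.mono fun _ h ↦ h.symm)
      (hYv.mono fun _ h ↦ h.symm)
  rw [curvature, key v hY hYv, key u hX hXu, hb, hD1.self_of_nhds]

end Connections

/-! ### The field Ω and its differentiability in the class 𝒲₁ -/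

section Structure

/-- The tensor `Q(x, y) = g(x, y) p - g(p, y) x + g(x, Py) q - g(q, y) Px`. -/
def distortion {V : Type*} [NormedAddCommGroup V] [InnerProductSpace ℝ V] (P : V → V)
    (p q x y : V) : V :=
  inner ℝ x y • p - inner ℝ p y • x + inner ℝ x (P y) • q - inner ℝ q y • P x

variable {E : Type*} [NormedAddCommGroup E] [NormedSpace ℝ E] [FiniteDimensional ℝ E]
  {M : Type*} [TopologicalSpace M] [ChartedSpace E M] [IsManifold 𝓘(ℝ, E) ∞ M]
  [RiemannianBundle (fun a : M ↦ TangentSpace 𝓘(ℝ, E) a)]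
  {a : M} {X Y Z W : Π b : M, TangentSpace 𝓘(ℝ, E) b}
  {P : Π b : M, TangentSpace 𝓘(ℝ, E) b →L[ℝ] TangentSpace 𝓘(ℝ, E) b}
  {D D' : Connection E M} {n : ℕ} {l m : ℝ}

theorem IsAlmostProduct.inner_left (hP : IsAlmostProduct P) (u v : TangentSpace 𝓘(ℝ, E) a) :
    inner ℝ (P a u) v = inner ℝ u (P a v) := by
  rw [← hP.isometry a u (P a v), hP.sq]

/-- The form θ is the inner product with ∑ (∇_{e_i} P) e_i, so it is linear, and Ω is the expansion
of that vector in the basis. -/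
theorem inner_omega (z : TangentSpace 𝓘(ℝ, E) a) :
    inner ℝ (omega D P a) z = theta D P a z := by
  have h : ∀ z : TangentSpace 𝓘(ℝ, E) a, theta D P a z =
      inner ℝ (∑ i, covDerivEnd D P a (stdOrthonormalBasis ℝ (TangentSpace 𝓘(ℝ, E) a) i)
        (stdOrthonormalBasis ℝ (TangentSpace 𝓘(ℝ, E) a) i)) z := by
    intro z
    simp only [theta, metricTrace, tensorF, sum_inner]
  rw [omega]
  simp only [h]
  set s := ∑ i, covDerivEnd D P a (stdOrthonormalBasis ℝ (TangentSpace 𝓘(ℝ, E) a) i)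
        (stdOrthonormalBasis ℝ (TangentSpace 𝓘(ℝ, E) a) i)
  congr 1
  conv_rhs => rw [← (stdOrthonormalBasis ℝ (TangentSpace 𝓘(ℝ, E) a)).sum_repr' s]
  simp only [real_inner_comm]

/-- On a +1 eigenvector g(y,Pz) = g(y,z), so the last two terms of the 𝒲₁ identity cancel. Only the
part of Ω in the -1 eigenspace is seen; the -1 eigenvectors of the next lemma see the other part. -/
theorem IsW1.covDerivEnd_of_eq (hn : 0 < n) (hP : IsAlmostProduct P) (hW : IsW1 D P n)
    {y : TangentSpace 𝓘(ℝ, E) a} (hy : P a y = y) :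
    (2 * n : ℝ) • covDerivEnd D P a y y
      = (inner ℝ y y : ℝ) • (omega D P a - P a (omega D P a)) := by
  refine ext_inner_right ℝ fun z ↦ ?_
  have h := hW a y y z
  have hn' : (n : ℝ) ≠ 0 := by positivity
  rw [tensorF, hy] at h
  rw [inner_smul_left, h, inner_smul_left, inner_sub_left, hP.inner_left, inner_omega, inner_omega]
  rw [← hP.inner_left, hy]
  simp only [RCLike.conj_to_real]
  field_simp
  ring

theorem IsW1.covDerivEnd_of_eq_neg (hn : 0 < n) (hP : IsAlmostProduct P) (hW : IsW1 D P n)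
    {y : TangentSpace 𝓘(ℝ, E) a} (hy : P a y = -y) :
    (2 * n : ℝ) • covDerivEnd D P a y y
      = (inner ℝ y y : ℝ) • (omega D P a + P a (omega D P a)) := by
  refine ext_inner_right ℝ fun z ↦ ?_
  have h := hW a y y z
  have hn' : (n : ℝ) ≠ 0 := by positivity
  have hθ : theta D P a (-y) = - theta D P a y := by
    rw [← inner_omega, ← inner_omega, inner_neg_right]
  rw [tensorF, hy, hθ] at h
  rw [inner_smul_left, h, inner_smul_left, inner_add_left, hP.inner_left, inner_omega, inner_omega]
  rw [← hP.inner_left, hy]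
  simp only [RCLike.conj_to_real, inner_neg_left, inner_neg_right]
  field_simp
  ring

/-- In the class `𝒲₁` the field `Ω` is determined by a nonzero vector in each eigenspace of `P`;
in particular it is smooth. -/
theorem IsW1.omega_eq (hn : 0 < n) (hP : IsAlmostProduct P) (hW : IsW1 D P n)
    {y z : TangentSpace 𝓘(ℝ, E) a} (hy : P a y = y) (hz : P a z = -z)
    (hy0 : (inner ℝ y y : ℝ) ≠ 0) (hz0 : (inner ℝ z z : ℝ) ≠ 0) :
    omega D P a = ((n : ℝ) * (inner ℝ y y)⁻¹) • covDerivEnd D P a y y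
      + ((n : ℝ) * (inner ℝ z z)⁻¹) • covDerivEnd D P a z z := by
  have h1 : (2 : ℝ) • ((n : ℝ) * (inner ℝ y y)⁻¹) • covDerivEnd D P a y y
      = omega D P a - P a (omega D P a) := by
    rw [← inv_smul_smul₀ hy0 (omega D P a - _), ← hW.covDerivEnd_of_eq hn hP hy]
    module
  have h2 : (2 : ℝ) • ((n : ℝ) * (inner ℝ z z)⁻¹) • covDerivEnd D P a z z
      = omega D P a + P a (omega D P a) := by
    rw [← inv_smul_smul₀ hz0 (omega D P a + _), ← hW.covDerivEnd_of_eq_neg hn hP hz]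
    module
  have h3 : (2 : ℝ) • omega D P a = (2 : ℝ) • (((n : ℝ) * (inner ℝ y y)⁻¹) • covDerivEnd D P a y y
      + ((n : ℝ) * (inner ℝ z z)⁻¹) • covDerivEnd D P a z z) := by
    rw [smul_add, h1, h2]
    module
  exact smul_right_injective _ two_ne_zero h3

/-- An endomorphism of trace zero of a space of positive dimension is not `-1`. -/
theorem exists_add_ne_zero_of_trace_eq_zero (hn : 0 < n) (hdim : Module.finrank ℝ E = 2 * n)
    (L : TangentSpace 𝓘(ℝ, E) a →ₗ[ℝ] TangentSpace 𝓘(ℝ, E) a)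
    (htr : LinearMap.trace ℝ (TangentSpace 𝓘(ℝ, E) a) L = 0) :
    ∃ u, u + L u ≠ 0 := by
  by_contra! h
  -- Otherwise the trace would be -2n. Used for P and for -P, this produces nonzero vectors in both
  -- eigenspaces.
  have hL : L = -LinearMap.id := by
    ext u
    exact eq_neg_of_add_eq_zero_right (h u)
  have hd : Module.finrank ℝ (TangentSpace 𝓘(ℝ, E) a) = 2 * n := hdim
  rw [hL, map_neg, LinearMap.trace_id, hd] at htr
  have : (n : ℝ) ≠ 0 := by positivity
  simp_all

variable [IsContMDiffRiemannianBundle 𝓘(ℝ, E) ∞ E (fun a : M ↦ TangentSpace 𝓘(ℝ, E) a)]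

theorem MDifferentiableAt.inner_section (hX : MDiffAt (T% X) a) (hY : MDiffAt (T% Y) a) :
    MDifferentiableAt 𝓘(ℝ, E) 𝓘(ℝ, ℝ) (fun b ↦ inner ℝ (X b) (Y b)) a := by
  have : IsContMDiffRiemannianBundle 𝓘(ℝ, E) 1 E (fun a : M ↦ TangentSpace 𝓘(ℝ, E) a) :=
    IsContMDiffRiemannianBundle.of_le (n := ∞) (by simp)
  exact MDifferentiableAt.inner_bundle hX hY

theorem mdifferentiableAt_omega [T2Space M] (hn : 0 < n) (hdim : Module.finrank ℝ E = 2 * n)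
    (hP : IsAlmostProduct P)
    (htr : ∀ a : M, LinearMap.trace ℝ (TangentSpace 𝓘(ℝ, E) a) (P a).toLinearMap = 0)
    (hD : CovariantDerivative.ContMDiffCovariantDerivative D ∞) (hW : IsW1 D P n) (a : M) :
    MDiffAt (T% (omega D P)) a := by
  obtain ⟨u, hu⟩ := exists_add_ne_zero_of_trace_eq_zero hn hdim _ (htr a)
  obtain ⟨v, hv⟩ := exists_add_ne_zero_of_trace_eq_zero hn hdim (-(P a).toLinearMap)
    (by rw [map_neg, htr a, neg_zero])
  obtain ⟨Y, hY, hYu⟩ := exists_contMDiff_eventuallyEq_extField u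
  obtain ⟨Z, hZ, hZv⟩ := exists_contMDiff_eventuallyEq_extField v
  have hYa : Y a = u := by simpa using hYu.self_of_nhds
  have hZa : Z a = v := by simpa using hZv.self_of_nhds
  have hPY := ContMDiff.end_apply hP.smooth hY
  have hPZ := ContMDiff.end_apply hP.smooth hZ
  -- Up to a factor 2, `A` and `B` are the projections of smooth fields to the +1 and -1
  -- eigenspaces. They are nonzero at `a`, hence near `a`, so Ω has the eigenvector formula on a
  -- neighbourhood.
  set A : Π b : M, TangentSpace 𝓘(ℝ, E) b := fun b ↦ Y b + P b (Y b)
  set B : Π b : M, TangentSpace 𝓘(ℝ, E) b := fun b ↦ Z b - P b (Z b)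
  have hA : CMDiff ∞ (T% A) := ContMDiff.add_section hY hPY
  have hB : CMDiff ∞ (T% B) := ContMDiff.sub_section hZ hPZ
  have hPA : ∀ b, P b (A b) = A b := fun b ↦ by simp [A, hP.sq, add_comm]
  have hPB : ∀ b, P b (B b) = -B b := fun b ↦ by simp [B, hP.sq]
  have hAa : (inner ℝ (A a) (A a) : ℝ) ≠ 0 := by
    rw [inner_self_ne_zero]
    simpa [A, hYa] using hu
  have hBa : (inner ℝ (B a) (B a) : ℝ) ≠ 0 := by
    rw [inner_self_ne_zero]
    simpa [B, hZa, sub_eq_add_neg] using hv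
  have hdiff : ∀ {C : Π b : M, TangentSpace 𝓘(ℝ, E) b}, CMDiff ∞ (T% C) →
      (inner ℝ (C a) (C a) : ℝ) ≠ 0 →
      MDiffAt (T% fun b ↦ ((n : ℝ) * (inner ℝ (C b) (C b))⁻¹) • covDerivEnd D P b (C b) (C b)) a
      ∧ ∀ᶠ b in 𝓝 a, (inner ℝ (C b) (C b) : ℝ) ≠ 0 := by
    intro C hC hCa
    have hi : ContMDiff 𝓘(ℝ, E) 𝓘(ℝ, ℝ) ∞ (fun b ↦ (inner ℝ (C b) (C b) : ℝ)) :=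
      ContMDiff.inner_bundle hC hC
    refine ⟨?_, hi.continuous.continuousAt.eventually_ne hCa⟩
    have hF : ∀ b, covDerivEnd D P b (C b) (C b)
        = D (fun c ↦ P c (C c)) b (C b) - P b (D C b (C b)) := fun b ↦
      covDerivEnd_apply hP.smooth (hC.mdifferentiableAt (by simp)) _
    have hs : MDiffAt (T% fun b ↦ covDerivEnd D P b (C b) (C b)) a := by
      simp only [hF]
      exact ((ContMDiff.sub_section
        (contMDiff_connection_apply hD (ContMDiff.end_apply hP.smooth hC) hC)
        (ContMDiff.end_apply hP.smooth (contMDiff_connection_apply hD hC hC)))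
          a).mdifferentiableAt (by simp)
    refine MDifferentiableAt.fun_smul_section ?_ hs
    exact ContMDiffAt.mdifferentiableAt (n := ∞)
      (contMDiffAt_const.mul ((hi a).inv₀ hCa)) (by simp)
  obtain ⟨hA1, hA2⟩ := hdiff hA hAa
  obtain ⟨hB1, hB2⟩ := hdiff hB hBa
  refine (MDifferentiableAt.fun_add_section hA1 hB1).congr_of_eventuallyEq ?_
  filter_upwards [hA2, hB2] with b h1 h2
  rw [← hW.omega_eq hn hP (hPA b) (hPB b) h1 h2]

end Structure

/-! ### The difference of the natural and the Levi-Civita connection -/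

section Difference

variable {E : Type*} [NormedAddCommGroup E] [NormedSpace ℝ E] [FiniteDimensional ℝ E]
  {M : Type*} [TopologicalSpace M] [ChartedSpace E M] [IsManifold 𝓘(ℝ, E) ∞ M]
  [RiemannianBundle (fun a : M ↦ TangentSpace 𝓘(ℝ, E) a)]
  {a : M} {X Y Z W : Π b : M, TangentSpace 𝓘(ℝ, E) b}
  {P : Π b : M, TangentSpace 𝓘(ℝ, E) b →L[ℝ] TangentSpace 𝓘(ℝ, E) b}
  {D D' : Connection E M} {n : ℕ} {l m : ℝ}

theorem inner_fieldP (hP : IsAlmostProduct P) (z : TangentSpace 𝓘(ℝ, E) a) :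
    (inner ℝ (fieldP D P n l m a) z : ℝ)
      = l * theta D P a z + (m + 1 / (2 * n : ℝ)) * theta D P a (P a z) := by
  rw [fieldP, inner_add_left, inner_smul_left, inner_smul_left, hP.inner_left, inner_omega,
    inner_omega]
  rfl

theorem inner_fieldQ (hP : IsAlmostProduct P) (z : TangentSpace 𝓘(ℝ, E) a) :
    (inner ℝ (fieldQ D P l m a) z : ℝ)
      = l * theta D P a (P a z) + m * theta D P a z := by
  rw [fieldQ, inner_add_left, inner_smul_left, inner_smul_left, hP.inner_left, inner_omega,
    inner_omega]
  rfl

/-- The separate 1/(2n) terms pair g with θ∘P, so they are absorbed by p alone; this is the source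
of the asymmetry between p and q. -/
theorem torsion_eq (hP : IsAlmostProduct P) (hT : HasTorsion D P n D' l m)
    (x y : TangentSpace 𝓘(ℝ, E) a) :
    D'.torsion a x y = (inner ℝ (fieldP D P n l m a) x : ℝ) • y
      - (inner ℝ (fieldP D P n l m a) y : ℝ) • x
      + (inner ℝ (fieldQ D P l m a) x : ℝ) • P a y
      - (inner ℝ (fieldQ D P l m a) y : ℝ) • P a x := by
  refine ext_inner_right ℝ fun z ↦ ?_
  rw [hT]
  simp only [inner_sub_left, inner_add_left, inner_smul_left, RCLike.conj_to_real,
    inner_fieldP hP, inner_fieldQ hP, hP.inner_left]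
  ring

/-- A metric connection differs from the Levi-Civita connection by the tensor determined by its
torsion. -/
theorem connection_eq_add_distortion (hP : IsAlmostProduct P) (hD : IsLeviCivita D)
    (hD' : IsMetric D') (hT : HasTorsion D P n D' l m)
    (hZ : MDiffAt (T% Z) a) (u : TangentSpace 𝓘(ℝ, E) a) :
    D' Z a u = D Z a u
      + distortion (P a) (fieldP D P n l m a) (fieldQ D P l m a) u (Z a) := by
  set p := fieldP D P n l m a
  set q := fieldQ D P l m a
  have hten : TensorialAt 𝓘(ℝ, E) E
      (fun Y : Π b : M, TangentSpace 𝓘(ℝ, E) b ↦ D' Y a u - D Y a u) a := by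
    constructor
    · intro f σ hf hσ
      have h1 := connection_smul (D := D) hf hσ u
      have h2 := connection_smul (D := D') hf hσ u
      change D' (fun b ↦ f b • σ b) a u - D (fun b ↦ f b • σ b) a u = _
      rw [h1, h2, smul_sub]
      abel
    · intro σ σ' hσ hσ'
      have h1 := connection_add (D := D) hσ hσ' u
      have h2 := connection_add (D := D') hσ hσ' u
      change D' (fun b ↦ σ b + σ' b) a u - D (fun b ↦ σ b + σ' b) a u = _
      rw [h1, h2]
      abel
  let S : TangentSpace 𝓘(ℝ, E) a → TangentSpace 𝓘(ℝ, E) a → TangentSpace 𝓘(ℝ, E) a :=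
    fun u w ↦ D' (extField w) a u - D (extField w) a u
  have hS : D' Z a u - D Z a u = S u (Z a) :=
    hten.pointwise hZ (mdifferentiableAt_extField _) (by simp)
  -- Both connections are metric, so the derivative of the inner product cancels in the difference.
  have hskew : ∀ u v w, (inner ℝ (S u v) w : ℝ) = - inner ℝ (S u w) v := by
    intro u v w
    have h1 := hD.metric a _ _ u (mdifferentiableAt_extField v) (mdifferentiableAt_extField w)
    have h2 := hD' a _ _ u (mdifferentiableAt_extField v) (mdifferentiableAt_extField w)
    simp only [FiberBundle.extend_apply_self] at h1 h2
    rw [h1] at h2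
    simp only [S, inner_sub_left]
    rw [real_inner_comm v (D' _ a u), real_inner_comm v (D _ a u)]
    linarith
  have htor : ∀ u v w, (inner ℝ (S u v) w : ℝ) - inner ℝ (S v u) w
      = inner ℝ p u * inner ℝ v w - inner ℝ p v * inner ℝ u w
        + inner ℝ q u * inner ℝ (P a v) w - inner ℝ q v * inner ℝ (P a u) w := by
    intro u v w
    have h1 := D.torsion_apply_eq_extend u v
    rw [hD.torsion_eq_zero] at h1
    have h2 := D'.torsion_apply_eq_extend u v
    rw [torsion_eq hP hT] at h2
    have h3 : S u v - S v u = D'.torsion a u v := by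
      rw [torsion_eq hP hT, h2]
      simp only [FiberBundle.extend_apply_self] at h1 ⊢
      rw [← sub_eq_zero.1 h1.symm]
      simp only [S]
      abel
    rw [← inner_sub_left, h3, torsion_eq hP hT]
    simp only [inner_sub_left, inner_add_left, inner_smul_left, RCLike.conj_to_real, p, q]
  have hfin : S u (Z a) = distortion (P a) p q u (Z a) := by
    refine ext_inner_right ℝ fun w ↦ ?_
    set v := Z a
    simp only [distortion, inner_sub_left, inner_add_left, inner_smul_left, RCLike.conj_to_real,
      hP.inner_left]
    -- Koszul's trick: with A(u,v,w) = g(S(u,v) - S(v,u), w), skewness of S in its last two slots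
    -- gives 2g(S(u,v),w) = A(u,v,w) - A(v,w,u) + A(w,u,v).
    have t1 := htor u v w
    have t2 := htor v w u
    have t3 := htor w u v
    rw [hP.inner_left, hP.inner_left] at t1
    rw [real_inner_comm u w, real_inner_comm u v, real_inner_comm u (P a w),
      real_inner_comm u (P a v)] at t2
    rw [real_inner_comm v w, hP.inner_left u v, real_inner_comm v (P a w)] at t3
    linarith [hskew u v w, hskew v w u, hskew w u v]
  rw [← hfin, ← hS]
  abel

end Difference

/-! ### Comparison of the curvature tensors -/

section Curvature

variable {E : Type*} [NormedAddCommGroup E] [NormedSpace ℝ E] [FiniteDimensional ℝ E]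
  {M : Type*} [TopologicalSpace M] [ChartedSpace E M] [IsManifold 𝓘(ℝ, E) ∞ M]
  [RiemannianBundle (fun a : M ↦ TangentSpace 𝓘(ℝ, E) a)]
  {a : M} {X Y Z W p q : Π b : M, TangentSpace 𝓘(ℝ, E) b}
  {P : Π b : M, TangentSpace 𝓘(ℝ, E) b →L[ℝ] TangentSpace 𝓘(ℝ, E) b}
  {D D' : Connection E M} {n : ℕ} {l m : ℝ}

theorem IsNatural.connection_end (hP : IsAlmostProduct P) (hD' : IsNatural D' P)
    (hY : MDiffAt (T% Y) a) (u : TangentSpace 𝓘(ℝ, E) a) :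
    D' (fun b ↦ P b (Y b)) a u = P a (D' Y a u) := by
  have h := covDerivEnd_apply (D := D') hP.smooth hY u
  rw [hD'.parallel] at h
  exact sub_eq_zero.1 h.symm

variable [IsContMDiffRiemannianBundle 𝓘(ℝ, E) ∞ E (fun a : M ↦ TangentSpace 𝓘(ℝ, E) a)]

theorem IsMetric.connection_inner_smul (hD' : IsMetric D') (hX : MDiffAt (T% X) a)
    (hY : MDiffAt (T% Y) a) (hZ : MDiffAt (T% Z) a) (u : TangentSpace 𝓘(ℝ, E) a) :
    D' (fun b ↦ (inner ℝ (X b) (Y b) : ℝ) • Z b) a u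
      = (inner ℝ (X a) (Y a) : ℝ) • D' Z a u
        + ((inner ℝ (D' X a u) (Y a) : ℝ) + inner ℝ (X a) (D' Y a u)) • Z a := by
  rw [connection_smul (MDifferentiableAt.inner_section hX hY) hZ, hD' a X Y u hX hY]

theorem MDifferentiableAt.inner_smul_section (hX : MDiffAt (T% X) a)
    (hY : MDiffAt (T% Y) a) (hZ : MDiffAt (T% Z) a) :
    MDiffAt (T% fun b ↦ (inner ℝ (X b) (Y b) : ℝ) • Z b) a :=
  MDifferentiableAt.fun_smul_section (MDifferentiableAt.inner_section hX hY) hZ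

/-- The covariant derivative of the tensor `Q` with respect to a natural connection is the
tensor of the same shape built from the derivatives of `p` and `q`. -/
theorem IsNatural.connection_distortion (hP : IsAlmostProduct P) (hD' : IsNatural D' P)
    (hp : MDiffAt (T% p) a) (hq : MDiffAt (T% q) a) (hY : MDiffAt (T% Y) a)
    (hZ : MDiffAt (T% Z) a) (u : TangentSpace 𝓘(ℝ, E) a) :
    D' (fun b ↦ distortion (P b) (p b) (q b) (Y b) (Z b)) a u
      = distortion (P a) (p a) (q a) (D' Y a u) (Z a)
        + distortion (P a) (p a) (q a) (Y a) (D' Z a u)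
        + distortion (P a) (D' p a u) (D' q a u) (Y a) (Z a) := by
  have hPY := MDifferentiableAt.end_apply hP.smooth hY
  have hPZ := MDifferentiableAt.end_apply hP.smooth hZ
  have h1 := MDifferentiableAt.inner_smul_section hY hZ hp
  have h2 := MDifferentiableAt.inner_smul_section hp hZ hY
  have h3 := MDifferentiableAt.inner_smul_section hY hPZ hq
  have h4 := MDifferentiableAt.inner_smul_section hq hZ hPY
  have h12 := MDifferentiableAt.fun_sub_section h1 h2
  have h123 := MDifferentiableAt.fun_add_section h12 h3
  simp only [distortion]
  rw [connection_sub h123 h4, connection_add h12 h3, connection_sub h1 h2,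
    hD'.metric.connection_inner_smul hY hZ hp, hD'.metric.connection_inner_smul hp hZ hY,
    hD'.metric.connection_inner_smul hY hPZ hq, hD'.metric.connection_inner_smul hq hZ hPY,
    hD'.connection_end hP hZ, hD'.connection_end hP hY]
  module

/-- The curvature tensors of the Levi-Civita connection and of the natural connection. -/
theorem curvature_eq [T2Space M] (hP : IsAlmostProduct P) (hD : IsLeviCivita D)
    (hD' : IsNatural D' P) (hT : HasTorsion D P n D' l m)
    (hp : MDiffAt (T% (fieldP D P n l m)) a) (hq : MDiffAt (T% (fieldQ D P l m)) a)
    (u v w : TangentSpace 𝓘(ℝ, E) a) :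
    curvature D a u v w = curvature D' a u v w
      - distortion (P a) (D' (fieldP D P n l m) a u) (D' (fieldQ D P l m) a u) v w
      + distortion (P a) (D' (fieldP D P n l m) a v) (D' (fieldQ D P l m) a v) u w
      - distortion (P a) (fieldP D P n l m a) (fieldQ D P l m a) (D'.torsion a u v) w
      + distortion (P a) (fieldP D P n l m a) (fieldQ D P l m a) u
          (distortion (P a) (fieldP D P n l m a) (fieldQ D P l m a) v w)
      - distortion (P a) (fieldP D P n l m a) (fieldQ D P l m a) v
          (distortion (P a) (fieldP D P n l m a) (fieldQ D P l m a) u w) := by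
  obtain ⟨X, hX, hXu⟩ := exists_contMDiff_eventuallyEq_extField u
  obtain ⟨Y, hY, hYv⟩ := exists_contMDiff_eventuallyEq_extField v
  obtain ⟨Z, hZ, hZw⟩ := exists_contMDiff_eventuallyEq_extField w
  have hXa : X a = u := by simpa using hXu.self_of_nhds
  have hYa : Y a = v := by simpa using hYv.self_of_nhds
  have hZa : Z a = w := by simpa using hZw.self_of_nhds
  rw [curvature_eq_of_eventuallyEq hD.smooth u v w hX hY hZ hXu hYv hZw,
    curvature_eq_of_eventuallyEq hD'.smooth u v w hX hY hZ hXu hYv hZw]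
  have hXd : ∀ b, MDiffAt (T% X) b := fun b ↦ (hX b).mdifferentiableAt (by simp)
  have hYd : ∀ b, MDiffAt (T% Y) b := fun b ↦ (hY b).mdifferentiableAt (by simp)
  have hZd : ∀ b, MDiffAt (T% Z) b := fun b ↦ (hZ b).mdifferentiableAt (by simp)
  have htor := D'.torsion_apply (hXd a) (hYd a)
  rw [hXa, hYa] at htor
  set p := fieldP D P n l m
  set q := fieldQ D P l m
  have hQ : ∀ b (x : TangentSpace 𝓘(ℝ, E) b),
      D Z b x = D' Z b x - distortion (P b) (p b) (q b) x (Z b) := by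
    intro b x
    rw [connection_eq_add_distortion hP hD hD'.metric hT (hZd b)]
    abel
  have key : ∀ {V : Π b : M, TangentSpace 𝓘(ℝ, E) b} (u : TangentSpace 𝓘(ℝ, E) a),
      CMDiff ∞ (T% V) →
      D (fun b ↦ D Z b (V b)) a u = D' (fun b ↦ D' Z b (V b)) a u
        - (distortion (P a) (p a) (q a) (D' V a u) w
          + distortion (P a) (p a) (q a) (V a) (D' Z a u)
          + distortion (P a) (D' p a u) (D' q a u) (V a) w)
        - distortion (P a) (p a) (q a) u
          (D' Z a (V a) - distortion (P a) (p a) (q a) (V a) w) := by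
    intro V u hV
    have hVd : MDiffAt (T% V) a := (hV a).mdifferentiableAt (by simp)
    have h1 : MDiffAt (T% fun b ↦ D Z b (V b)) a :=
      (contMDiff_connection_apply hD.smooth hZ hV a).mdifferentiableAt (by simp)
    have h2 : MDiffAt (T% fun b ↦ D' Z b (V b)) a :=
      (contMDiff_connection_apply hD'.smooth hZ hV a).mdifferentiableAt (by simp)
    -- Along smooth fields Q is the difference of two smooth covariant derivatives.
    have h3 : MDiffAt (T% fun b ↦ distortion (P b) (p b) (q b) (V b) (Z b)) a := by
      have h : ∀ b, distortion (P b) (p b) (q b) (V b) (Z b)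
          = D' Z b (V b) - D Z b (V b) := by
        intro b
        rw [hQ]
        abel
      simp only [h]
      exact MDifferentiableAt.fun_sub_section h2 h1
    have h4 : (fun b ↦ D Z b (V b))
        = fun b ↦ D' Z b (V b) - distortion (P b) (p b) (q b) (V b) (Z b) := by
      ext b
      rw [hQ]
    have h5 := connection_eq_add_distortion hP hD hD'.metric hT h1 u
    rw [← sub_eq_iff_eq_add] at h5
    rw [← h5]
    simp only [h4]
    rw [connection_sub h2 h3, hD'.connection_distortion hP hp hq hVd (hZd a), hQ, hZa]
  rw [key u hY, key v hX, hQ, hXa, hYa, hZa]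
  -- The terms Q(∇'_u Y - ∇'_v X, w) and Q([X,Y],w) combine to Q(T(u,v),w), and those containing ∇'Z
  -- inside Q cancel, so no trace of the extensions remains.
  have hbr : VectorField.mlieBracket 𝓘(ℝ, E) X Y a
      = D' Y a u - D' X a v - D'.torsion a u v := by
    rw [htor]
    abel
  rw [hbr]
  simp only [distortion, inner_add_right, inner_sub_right, inner_smul_right, inner_sub_left,
    map_sub, map_add, map_smul]
  module

end Curvature

/-! ### Contractions of Q in a single inner product space -/

section Traces

variable {V : Type*} [NormedAddCommGroup V] [InnerProductSpace ℝ V] {ι : Type*} [Fintype ι]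

/-- The tensor `Q` as a linear function of its first argument. -/
def distortionLeft (P : V →ₗ[ℝ] V) (p q z : V) : V →ₗ[ℝ] V where
  toFun x := distortion P p q x z
  map_add' x y := by
    simp only [distortion, inner_add_left, map_add]
    module
  map_smul' c x := by
    simp only [distortion, inner_smul_left, map_smul, RCLike.conj_to_real, RingHom.id_apply]
    module

/-- Expand y in the basis. All contractions below reduce to this identity, to tr P = 0 and to the
dimension count. -/
theorem sum_inner_mul_inner_map (b : OrthonormalBasis ι ℝ V) (L : V →ₗ[ℝ] V) (x y : V) :
    ∑ i, (inner ℝ x (L (b i)) : ℝ) * inner ℝ y (b i) = inner ℝ x (L y) := by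
  conv_rhs => rw [← b.sum_repr' y]
  simp only [map_sum, map_smul, inner_sum, inner_smul_right]
  exact Finset.sum_congr rfl fun i _ ↦ by rw [real_inner_comm y, mul_comm]

theorem sum_inner_mul_inner_basis (b : OrthonormalBasis ι ℝ V) (x y : V) :
    ∑ i, (inner ℝ x (b i) : ℝ) * inner ℝ y (b i) = inner ℝ x y :=
  sum_inner_mul_inner_map b LinearMap.id x y

theorem sum_inner_self_basis (b : OrthonormalBasis ι ℝ V) :
    ∑ i, (inner ℝ (b i) (b i) : ℝ) = Fintype.card ι := by
  simp [b.orthonormal.1]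

variable (b : OrthonormalBasis ι ℝ V) (P : V →ₗ[ℝ] V)
  (hsym : ∀ x y, (inner ℝ (P x) y : ℝ) = inner ℝ x (P y)) (hsq : ∀ x, P (P x) = x)
  (htr : ∑ i, (inner ℝ (P (b i)) (b i) : ℝ) = 0)

theorem sum_inner_distortion_deriv (p' q' : V →ₗ[ℝ] V) (y z : V) :
    ∑ i, (inner ℝ (distortion P (p' (b i)) (q' (b i)) y z) (b i) : ℝ)
      = inner ℝ y z * ∑ i, (inner ℝ (p' (b i)) (b i) : ℝ) - inner ℝ (p' y) z
        + inner ℝ y (P z) * ∑ i, (inner ℝ (q' (b i)) (b i) : ℝ) - inner ℝ (q' (P y)) z := by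
  have h1 := sum_inner_mul_inner_map b p' z y
  have h2 := sum_inner_mul_inner_map b q' z (P y)
  simp only [real_inner_comm _ z] at h1 h2
  simp only [distortion, inner_sub_left, inner_add_left, inner_smul_left, RCLike.conj_to_real,
    Finset.sum_sub_distrib, Finset.sum_add_distrib, ← Finset.mul_sum, h1, h2]

include htr in
theorem sum_inner_distortion_left (p q z : V) :
    ∑ i, (inner ℝ (distortion P p q (b i) z) (b i) : ℝ)
      = (1 - Fintype.card ι) * inner ℝ p z + inner ℝ q (P z) := by
  have h1 := sum_inner_mul_inner_basis b z p
  have h2 := sum_inner_mul_inner_basis b (P z) q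
  simp only [distortion, inner_sub_left, inner_add_left, inner_smul_left, RCLike.conj_to_real,
    Finset.sum_sub_distrib, Finset.sum_add_distrib, ← Finset.mul_sum, htr,
    sum_inner_self_basis, real_inner_comm z (b _), real_inner_comm (P z) (b _), h1, h2]
  rw [real_inner_comm p z, real_inner_comm q (P z)]
  ring

-- Replacing the first argument of Q by its image under P exchanges the roles of p and q, as P² = 1.
include hsym hsq htr in
theorem sum_inner_distortion_end (p q z : V) :
    ∑ i, (inner ℝ (distortion P p q (P (b i)) z) (b i) : ℝ)
      = (1 - Fintype.card ι) * inner ℝ q z + inner ℝ p (P z) := by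
  have h1 := sum_inner_mul_inner_basis b (P z) p
  have h2 := sum_inner_mul_inner_basis b z q
  have e : ∀ x, (inner ℝ (P x) z : ℝ) = inner ℝ (P z) x := fun x ↦ by
    rw [hsym, real_inner_comm]
  have e' : ∀ x, (inner ℝ (P x) (P z) : ℝ) = inner ℝ z x := fun x ↦ by
    rw [hsym, hsq, real_inner_comm]
  simp only [distortion, inner_sub_left, inner_add_left, inner_smul_left, RCLike.conj_to_real,
    Finset.sum_sub_distrib, Finset.sum_add_distrib, ← Finset.mul_sum, htr, hsq, e, e',
    sum_inner_self_basis, h1, h2]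
  rw [real_inner_comm q z, real_inner_comm p (P z)]
  ring

-- Paired with a vector, Q(y,·) is a sum of four products of inner products, so each term is a
-- contraction of the linear map Q(·,z).
include hsym in
theorem sum_inner_distortion_comp (p q y z : V) :
    ∑ i, (inner ℝ (distortion P p q y (distortion P p q (b i) z)) (b i) : ℝ)
      = inner ℝ y (distortion P p q p z) - inner ℝ p (distortion P p q y z)
        + inner ℝ (P y) (distortion P p q q z) - inner ℝ q (distortion P p q (P y) z) := by
  have h : ∀ x x', ∑ i, (inner ℝ x (distortion P p q (b i) z) : ℝ) * inner ℝ x' (b i)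
      = inner ℝ x (distortion P p q x' z) :=
    sum_inner_mul_inner_map b (distortionLeft P p q z)
  have e : ∀ w v : V, (inner ℝ (distortion P p q y w) v : ℝ) = inner ℝ y w * inner ℝ p v
      - inner ℝ p w * inner ℝ y v + inner ℝ (P y) w * inner ℝ q v
      - inner ℝ q w * inner ℝ (P y) v := by
    intro w v
    rw [hsym]
    simp only [distortion, inner_sub_left, inner_add_left, inner_smul_left, RCLike.conj_to_real]
  simp only [e, Finset.sum_sub_distrib, Finset.sum_add_distrib, h]

include hsym hsq htr in
theorem sum_inner_distortion_torsion (p q y z : V) :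
    ∑ i, (inner ℝ (distortion P p q ((inner ℝ p (b i) : ℝ) • y - (inner ℝ p y : ℝ) • b i
        + (inner ℝ q (b i) : ℝ) • P y - (inner ℝ q y : ℝ) • P (b i)) z) (b i) : ℝ)
      = inner ℝ (distortion P p q y z) p
        - inner ℝ p y * ((1 - Fintype.card ι) * inner ℝ p z + inner ℝ q (P z))
        + inner ℝ (distortion P p q (P y) z) q
        - inner ℝ q y * ((1 - Fintype.card ι) * inner ℝ q z + inner ℝ p (P z)) := by
  have e : ∀ x v : V, (inner ℝ (distortion P p q ((inner ℝ p x : ℝ) • y - (inner ℝ p y : ℝ) • x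
        + (inner ℝ q x : ℝ) • P y - (inner ℝ q y : ℝ) • P x) z) v : ℝ)
      = inner ℝ (distortion P p q y z) v * inner ℝ p x
        - inner ℝ p y * inner ℝ (distortion P p q x z) v
        + inner ℝ (distortion P p q (P y) z) v * inner ℝ q x
        - inner ℝ q y * inner ℝ (distortion P p q (P x) z) v := by
    intro x v
    change (inner ℝ (distortionLeft P p q z _) v : ℝ) = _
    simp only [map_sub, map_add, map_smul, inner_sub_left, inner_add_left, inner_smul_left,
      RCLike.conj_to_real]
    simp only [distortionLeft, LinearMap.coe_mk, AddHom.coe_mk]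
    ring
  simp only [e, Finset.sum_sub_distrib, Finset.sum_add_distrib, ← Finset.mul_sum,
    sum_inner_mul_inner_basis, sum_inner_distortion_left b P htr,
    sum_inner_distortion_end b P hsym hsq htr]

include hsym hsq htr in
/-- The contraction of the difference of the two curvature tensors. -/
theorem sum_inner_curvature_difference (p' q' : V →ₗ[ℝ] V) (p q y z : V) :
    - ∑ i, (inner ℝ (distortion P (p' (b i)) (q' (b i)) y z) (b i) : ℝ)
      + ∑ i, (inner ℝ (distortion P (p' y) (q' y) (b i) z) (b i) : ℝ)
      - ∑ i, (inner ℝ (distortion P p q ((inner ℝ p (b i) : ℝ) • y - (inner ℝ p y : ℝ) • b i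
        + (inner ℝ q (b i) : ℝ) • P y - (inner ℝ q y : ℝ) • P (b i)) z) (b i) : ℝ)
      + ∑ i, (inner ℝ (distortion P p q (b i) (distortion P p q y z)) (b i) : ℝ)
      - ∑ i, (inner ℝ (distortion P p q y (distortion P p q (b i) z)) (b i) : ℝ)
      = - ((Fintype.card ι - 1) * inner ℝ p p + (∑ i, (inner ℝ (p' (b i)) (b i) : ℝ)
          - inner ℝ p (P q)) ) * inner ℝ y z
        - (∑ i, (inner ℝ (q' (b i)) (b i) : ℝ) + inner ℝ p q - inner ℝ q (P q)
          + (Fintype.card ι - 2) * inner ℝ p q) * inner ℝ y (P z)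
        - (Fintype.card ι - 2)
          * (inner ℝ (p' y) z - (inner ℝ p (P y) - inner ℝ q y) * inner ℝ q z)
        + (inner ℝ (q' y) (P z) + (inner ℝ p y - inner ℝ q (P y)) * inner ℝ q (P z))
        + (inner ℝ (q' (P y)) z + (inner ℝ p (P y) - inner ℝ q y) * inner ℝ q z) := by
  rw [sum_inner_distortion_deriv b P, sum_inner_distortion_left b P htr,
    sum_inner_distortion_torsion b P hsym hsq htr, sum_inner_distortion_left b P htr,
    sum_inner_distortion_comp b P hsym]
  simp only [distortion, inner_sub_left, inner_add_left, inner_smul_left, RCLike.conj_to_real,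
    inner_sub_right, inner_add_right, inner_smul_right, map_sub, map_add, map_smul, hsym, hsq]
  -- Symmetry of g and of g(·,P·) brings the scalar products to one normal form, after which the
  -- identity is polynomial.
  have c : ∀ x y : V, (inner ℝ x (P y) : ℝ) = inner ℝ y (P x) := fun x y ↦ by
    rw [← hsym, real_inner_comm]
  rw [real_inner_comm p y, real_inner_comm q y, real_inner_comm p q, c y p, c y q, c q p]
  ring

end Traces

/-! ### The tensors U, V, S', S'' in terms of p and q, their traces, and the Ricci tensor -/

section Contractions

variable {E : Type*} [NormedAddCommGroup E] [NormedSpace ℝ E] [FiniteDimensional ℝ E]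
  {M : Type*} [TopologicalSpace M] [ChartedSpace E M] [IsManifold 𝓘(ℝ, E) ∞ M]
  [RiemannianBundle (fun a : M ↦ TangentSpace 𝓘(ℝ, E) a)]
  {a : M} {P : Π b : M, TangentSpace 𝓘(ℝ, E) b →L[ℝ] TangentSpace 𝓘(ℝ, E) b}
  {D D' : Connection E M} {n : ℕ} {l m : ℝ}

theorem mdifferentiableAt_fieldP (hP : IsAlmostProduct P) (hΩ : MDiffAt (T% (omega D P)) a) :
    MDiffAt (T% (fieldP D P n l m)) a :=
  MDifferentiableAt.fun_add_section (MDifferentiableAt.const_smul_section _ hΩ)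
    (MDifferentiableAt.const_smul_section _ (MDifferentiableAt.end_apply hP.smooth hΩ))

theorem mdifferentiableAt_fieldQ (hP : IsAlmostProduct P) (hΩ : MDiffAt (T% (omega D P)) a) :
    MDiffAt (T% (fieldQ D P l m)) a :=
  MDifferentiableAt.fun_add_section
    (MDifferentiableAt.const_smul_section _ (MDifferentiableAt.end_apply hP.smooth hΩ))
    (MDifferentiableAt.const_smul_section _ hΩ)

theorem covDerivForm_theta (hD' : IsMetric D') (hΩ : MDiffAt (T% (omega D P)) a)
    (u w : TangentSpace 𝓘(ℝ, E) a) :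
    covDerivForm D' (theta D P) a u w = inner ℝ (D' (omega D P) a u) w := by
  have h := hD' a _ _ u hΩ (mdifferentiableAt_extField w)
  simp only [inner_omega, FiberBundle.extend_apply_self] at h
  rw [covDerivForm, h, add_sub_cancel_right]

/-- As P is ∇'-parallel and symmetric, it can be moved from w onto ∇'Ω and then inside the
derivative. The same reasoning applies to V and q. -/
theorem tensorU_eq (hP : IsAlmostProduct P) (hD' : IsNatural D' P)
    (hΩ : MDiffAt (T% (omega D P)) a) (u w : TangentSpace 𝓘(ℝ, E) a) :
    tensorU D P n D' l m a u w = inner ℝ (D' (fieldP D P n l m) a u) w := by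
  have hPΩ := MDifferentiableAt.end_apply hP.smooth hΩ
  have h : D' (fieldP D P n l m) a u = l • D' (omega D P) a u
      + (m + 1 / (2 * n : ℝ)) • P a (D' (omega D P) a u) := by
    rw [← hD'.connection_end hP hΩ, ← connection_const_smul _ hΩ, ← connection_const_smul _ hPΩ]
    exact connection_add (MDifferentiableAt.const_smul_section _ hΩ)
      (MDifferentiableAt.const_smul_section _ hPΩ) u
  rw [h, tensorU, covDerivForm_theta hD'.metric hΩ, covDerivForm_theta hD'.metric hΩ]
  simp only [inner_add_left, inner_smul_left, RCLike.conj_to_real, hP.inner_left]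

theorem tensorV_eq (hP : IsAlmostProduct P) (hD' : IsNatural D' P)
    (hΩ : MDiffAt (T% (omega D P)) a) (u w : TangentSpace 𝓘(ℝ, E) a) :
    tensorV D P D' l m a u w = inner ℝ (D' (fieldQ D P l m) a u) w := by
  have hPΩ := MDifferentiableAt.end_apply hP.smooth hΩ
  have h : D' (fieldQ D P l m) a u = l • P a (D' (omega D P) a u)
      + m • D' (omega D P) a u := by
    rw [← hD'.connection_end hP hΩ, ← connection_const_smul _ hΩ, ← connection_const_smul _ hPΩ]
    exact connection_add (MDifferentiableAt.const_smul_section _ hPΩ)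
      (MDifferentiableAt.const_smul_section _ hΩ) u
  rw [h, tensorV, covDerivForm_theta hD'.metric hΩ, covDerivForm_theta hD'.metric hΩ]
  simp only [inner_add_left, inner_smul_left, RCLike.conj_to_real, hP.inner_left]

/-- The factor g(p,Py) - g(q,y) equals θ(y)/(2n). This is the form in which S' appears when the
curvature is contracted; for S'' the factor is the same with y replaced by Py. -/
theorem tensorS₁_eq (hP : IsAlmostProduct P) (hD' : IsNatural D' P)
    (hΩ : MDiffAt (T% (omega D P)) a) (y z : TangentSpace 𝓘(ℝ, E) a) :
    tensorS₁ D P n D' l m a y z = inner ℝ (D' (fieldP D P n l m) a y) z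
      - (inner ℝ (fieldP D P n l m a) (P a y) - inner ℝ (fieldQ D P l m a) y)
        * inner ℝ (fieldQ D P l m a) z := by
  rw [tensorS₁, tensorU_eq hP hD' hΩ, inner_fieldP hP, inner_fieldQ hP, inner_fieldQ hP, hP.sq]
  ring

theorem tensorS₂_eq (hP : IsAlmostProduct P) (hD' : IsNatural D' P)
    (hΩ : MDiffAt (T% (omega D P)) a) (y z : TangentSpace 𝓘(ℝ, E) a) :
    tensorS₂ D P n D' l m a y z = inner ℝ (D' (fieldQ D P l m) a y) (P a z)
      + (inner ℝ (fieldP D P n l m a) y - inner ℝ (fieldQ D P l m a) (P a y))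
        * inner ℝ (fieldQ D P l m a) (P a z) := by
  rw [tensorS₂, tensorV_eq hP hD' hΩ, inner_fieldP hP, inner_fieldQ hP, inner_fieldQ hP, hP.sq,
    hP.sq]
  ring

theorem metricTrace_inner_mul_inner (x y : TangentSpace 𝓘(ℝ, E) a) :
    metricTrace a (fun u v ↦ (inner ℝ x u : ℝ) * inner ℝ y v) = inner ℝ x y :=
  sum_inner_mul_inner_basis (stdOrthonormalBasis ℝ (TangentSpace 𝓘(ℝ, E) a)) x y

theorem metricTrace_inner_left (L : TangentSpace 𝓘(ℝ, E) a →ₗ[ℝ] TangentSpace 𝓘(ℝ, E) a) :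
    metricTrace a (fun u v ↦ (inner ℝ (L u) v : ℝ)) = LinearMap.trace ℝ _ L := by
  rw [LinearMap.trace_eq_sum_inner L (stdOrthonormalBasis ℝ (TangentSpace 𝓘(ℝ, E) a))]
  exact Finset.sum_congr rfl fun i _ ↦ real_inner_comm _ _

theorem metricTrace_add (B C : TangentSpace 𝓘(ℝ, E) a → TangentSpace 𝓘(ℝ, E) a → ℝ) :
    metricTrace a (fun u v ↦ B u v + C u v) = metricTrace a B + metricTrace a C :=
  Finset.sum_add_distrib

theorem metricTrace_sub (B C : TangentSpace 𝓘(ℝ, E) a → TangentSpace 𝓘(ℝ, E) a → ℝ) :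
    metricTrace a (fun u v ↦ B u v - C u v) = metricTrace a B - metricTrace a C :=
  Finset.sum_sub_distrib ..

theorem metricTrace_const_mul (c : ℝ)
    (B : TangentSpace 𝓘(ℝ, E) a → TangentSpace 𝓘(ℝ, E) a → ℝ) :
    metricTrace a (fun u v ↦ c * B u v) = c * metricTrace a B :=
  (Finset.mul_sum ..).symm

theorem metricTrace_inner (a : M) :
    metricTrace a (fun u v : TangentSpace 𝓘(ℝ, E) a ↦ inner ℝ u v) = Module.finrank ℝ E := by
  rw [metricTrace, sum_inner_self_basis, Fintype.card_fin]
  rfl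

theorem metricTrace_tensorS₁ (hP : IsAlmostProduct P) (hD' : IsNatural D' P)
    (hΩ : MDiffAt (T% (omega D P)) a) :
    metricTrace a (tensorS₁ D P n D' l m a)
      = metricTrace a (fun u v ↦ inner ℝ (D' (fieldP D P n l m) a u) v)
        - inner ℝ (fieldP D P n l m a) (P a (fieldQ D P l m a))
        + inner ℝ (fieldQ D P l m a) (fieldQ D P l m a) := by
  have h : tensorS₁ D P n D' l m a = fun y z ↦ inner ℝ (D' (fieldP D P n l m) a y) z
      - ((inner ℝ (P a (fieldP D P n l m a)) y : ℝ) * inner ℝ (fieldQ D P l m a) z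
        - inner ℝ (fieldQ D P l m a) y * inner ℝ (fieldQ D P l m a) z) := by
    ext y z
    rw [tensorS₁_eq hP hD' hΩ, hP.inner_left]
    ring
  rw [h]
  simp only [metricTrace_sub, metricTrace_inner_mul_inner]
  rw [hP.inner_left]
  ring

theorem metricTrace_tensorS₂_end (hP : IsAlmostProduct P) (hD' : IsNatural D' P)
    (hΩ : MDiffAt (T% (omega D P)) a) :
    metricTrace a (fun v w ↦ tensorS₂ D P n D' l m a v (P a w))
      = metricTrace a (fun u v ↦ inner ℝ (D' (fieldQ D P l m) a u) v)
        + inner ℝ (fieldP D P n l m a) (fieldQ D P l m a)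
        - inner ℝ (fieldQ D P l m a) (P a (fieldQ D P l m a)) := by
  have h : (fun v w ↦ tensorS₂ D P n D' l m a v (P a w))
      = fun y z ↦ inner ℝ (D' (fieldQ D P l m) a y) z
      + ((inner ℝ (fieldP D P n l m a) y : ℝ) * inner ℝ (fieldQ D P l m a) z
        - inner ℝ (P a (fieldQ D P l m a)) y * inner ℝ (fieldQ D P l m a) z) := by
    ext y z
    rw [tensorS₂_eq hP hD' hΩ, hP.inner_left, hP.sq]
    ring
  rw [h]
  simp only [metricTrace_sub, metricTrace_add, metricTrace_inner_mul_inner]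
  rw [hP.inner_left]
  ring

/-- The derivative parts are the traces of (∇'q)∘P and P∘(∇'q), equal by cyclicity; the quadratic
parts agree because P is symmetric and orthogonal. This gives the factor 2 before tr S'' in τ. -/
theorem metricTrace_tensorS₂_end_end (hP : IsAlmostProduct P) (hD' : IsNatural D' P)
    (hΩ : MDiffAt (T% (omega D P)) a) :
    metricTrace a (fun v w ↦ tensorS₂ D P n D' l m a (P a v) (P a w))
      = metricTrace a (tensorS₂ D P n D' l m a) := by
  set p := fieldP D P n l m a with hp
  set q := fieldQ D P l m a with hq
  set L : TangentSpace 𝓘(ℝ, E) a →ₗ[ℝ] TangentSpace 𝓘(ℝ, E) a :=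
    (D' (fieldQ D P l m) a).toLinearMap with hL
  set K : TangentSpace 𝓘(ℝ, E) a →ₗ[ℝ] TangentSpace 𝓘(ℝ, E) a := (P a).toLinearMap with hK
  have h1 : (fun v w ↦ tensorS₂ D P n D' l m a (P a v) (P a w))
      = fun y z ↦ inner ℝ ((L * K) y) z
      + ((inner ℝ (P a p) y : ℝ) * inner ℝ q z - inner ℝ q y * inner ℝ q z) := by
    ext y z
    rw [tensorS₂_eq hP hD' hΩ, hP.inner_left, hP.sq, hP.sq, ← hp, ← hq, Module.End.mul_apply, hL,
      hK]
    simp only [ContinuousLinearMap.coe_coe]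
    ring
  have h2 : tensorS₂ D P n D' l m a = fun y z ↦ inner ℝ ((K * L) y) z
      + ((inner ℝ p y : ℝ) * inner ℝ (P a q) z
        - inner ℝ (P a q) y * inner ℝ (P a q) z) := by
    ext y z
    rw [tensorS₂_eq hP hD' hΩ, Module.End.mul_apply, hL, hK]
    simp only [ContinuousLinearMap.coe_coe, hP.inner_left, ← hp, ← hq]
    ring
  rw [h1, h2]
  simp only [metricTrace_sub, metricTrace_add, metricTrace_inner_mul_inner,
    metricTrace_inner_left, LinearMap.trace_mul_comm ℝ L K]
  rw [hP.inner_left, hP.isometry]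

variable [IsContMDiffRiemannianBundle 𝓘(ℝ, E) ∞ E (fun a : M ↦ TangentSpace 𝓘(ℝ, E) a)]

theorem ricci_eq [T2Space M] (hdim : Module.finrank ℝ E = 2 * n) (hP : IsAlmostProduct P)
    (htr : LinearMap.trace ℝ (TangentSpace 𝓘(ℝ, E) a) (P a).toLinearMap = 0)
    (hD : IsLeviCivita D) (hD' : IsNatural D' P) (hT : HasTorsion D P n D' l m)
    (hΩ : MDiffAt (T% (omega D P)) a) (y z : TangentSpace 𝓘(ℝ, E) a) :
    ricci D a y z = ricci D' a y z
      - ((2 * n - 1) * inner ℝ (fieldP D P n l m a) (fieldP D P n l m a)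
          + metricTrace a (tensorS₁ D P n D' l m a)
          - inner ℝ (fieldQ D P l m a) (fieldQ D P l m a)) * inner ℝ y z
      - (metricTrace a (fun v w ↦ tensorS₂ D P n D' l m a v (P a w))
          + 2 * (n - 1) * inner ℝ (fieldP D P n l m a) (fieldQ D P l m a)) * inner ℝ y (P a z)
      - 2 * (n - 1) * tensorS₁ D P n D' l m a y z
      + tensorS₂ D P n D' l m a y z + tensorS₂ D P n D' l m a (P a y) (P a z) := by
  have hcurv := curvature_eq hP hD hD' hT (mdifferentiableAt_fieldP hP hΩ)
    (mdifferentiableAt_fieldQ hP hΩ)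
  simp only [torsion_eq hP hT] at hcurv
  have htr' := metricTrace_inner_left (P a).toLinearMap
  rw [htr] at htr'
  have h := sum_inner_curvature_difference (stdOrthonormalBasis ℝ (TangentSpace 𝓘(ℝ, E) a))
    (P a).toLinearMap hP.inner_left (hP.sq a) htr' (D' (fieldP D P n l m) a).toLinearMap
    (D' (fieldQ D P l m) a).toLinearMap (fieldP D P n l m a) (fieldQ D P l m a) y z
  have hcard : (Fintype.card (Fin (Module.finrank ℝ (TangentSpace 𝓘(ℝ, E) a))) : ℝ) = 2 * n := by
    rw [Fintype.card_fin]
    exact_mod_cast hdim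
  rw [hcard] at h
  rw [metricTrace_tensorS₁ hP hD' hΩ, metricTrace_tensorS₂_end hP hD' hΩ, tensorS₁_eq hP hD' hΩ,
    tensorS₂_eq hP hD' hΩ, tensorS₂_eq hP hD' hΩ, hP.sq, hP.sq]
  simp only [ricci, metricTrace, hcurv, inner_add_left, inner_sub_left, Finset.sum_add_distrib,
    Finset.sum_sub_distrib]
  simp only [ContinuousLinearMap.coe_coe] at h
  linear_combination h

end Contractions

end RiemannianProduct

end

/-! ### The Ricci and scalar curvature formulas -/

theorem corollary3p2
    {E : Type*} [NormedAddCommGroup E] [NormedSpace ℝ E] [FiniteDimensional ℝ E]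
    {M : Type*} [TopologicalSpace M] [T2Space M] [ChartedSpace E M] [IsManifold 𝓘(ℝ, E) ∞ M]
    [RiemannianBundle (fun a : M ↦ TangentSpace 𝓘(ℝ, E) a)]
    [IsContMDiffRiemannianBundle 𝓘(ℝ, E) ∞ E (fun a : M ↦ TangentSpace 𝓘(ℝ, E) a)]
    (n : ℕ) (hn : 0 < n) (hdim : Module.finrank ℝ E = 2 * n)
    (P : Π a : M, TangentSpace 𝓘(ℝ, E) a →L[ℝ] TangentSpace 𝓘(ℝ, E) a)
    (hP : RiemannianProduct.IsAlmostProduct P)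
    (htr : ∀ a : M, LinearMap.trace ℝ (TangentSpace 𝓘(ℝ, E) a) (P a).toLinearMap = 0)
    (D : RiemannianProduct.Connection E M) (hD : RiemannianProduct.IsLeviCivita D)
    (hW : RiemannianProduct.IsW1 D P n)
    (D' : RiemannianProduct.Connection E M) (hD' : RiemannianProduct.IsNatural D' P)
    (l m : ℝ) (hT : RiemannianProduct.HasTorsion D P n D' l m) :
    (∀ (a : M) (y z : TangentSpace 𝓘(ℝ, E) a),
      RiemannianProduct.ricci D a y z =
        RiemannianProduct.ricci D' a y z
        - ((2 * n - 1) * inner ℝ (RiemannianProduct.fieldP D P n l m a)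
              (RiemannianProduct.fieldP D P n l m a)
            + RiemannianProduct.metricTrace a (RiemannianProduct.tensorS₁ D P n D' l m a)
            - inner ℝ (RiemannianProduct.fieldQ D P l m a)
              (RiemannianProduct.fieldQ D P l m a)) * inner ℝ y z
        - (RiemannianProduct.metricTrace a
              (fun v w ↦ RiemannianProduct.tensorS₂ D P n D' l m a v (P a w))
            + 2 * (n - 1) * inner ℝ (RiemannianProduct.fieldP D P n l m a)
              (RiemannianProduct.fieldQ D P l m a)) * inner ℝ y (P a z)
        - 2 * (n - 1) * RiemannianProduct.tensorS₁ D P n D' l m a y z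
        + RiemannianProduct.tensorS₂ D P n D' l m a y z
        + RiemannianProduct.tensorS₂ D P n D' l m a (P a y) (P a z)) ∧
    (∀ a : M,
      RiemannianProduct.scalarCurvature D a =
        RiemannianProduct.scalarCurvature D' a
        - 2 * n * (2 * n - 1) * inner ℝ (RiemannianProduct.fieldP D P n l m a)
            (RiemannianProduct.fieldP D P n l m a)
        + 2 * n * inner ℝ (RiemannianProduct.fieldQ D P l m a)
            (RiemannianProduct.fieldQ D P l m a)
        - 2 * (2 * n - 1)
            * RiemannianProduct.metricTrace a (RiemannianProduct.tensorS₁ D P n D' l m a)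
        + 2 * RiemannianProduct.metricTrace a
            (RiemannianProduct.tensorS₂ D P n D' l m a)) := by
  have hΩ := RiemannianProduct.mdifferentiableAt_omega hn hdim hP htr hD.smooth hW
  have hricci := fun (a : M) (y z : TangentSpace 𝓘(ℝ, E) a) ↦
    RiemannianProduct.ricci_eq hdim hP (htr a) hD hD' hT (hΩ a) y z
  refine ⟨hricci, fun a ↦ ?_⟩
  have hsc : RiemannianProduct.scalarCurvature D a = _ :=
    congrArg (RiemannianProduct.metricTrace a) (funext₂ (hricci a))
  have htrP : RiemannianProduct.metricTrace a
      (fun u v : TangentSpace 𝓘(ℝ, E) a ↦ inner ℝ u (P a v)) = 0 := by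
    have h := RiemannianProduct.metricTrace_inner_left (P a).toLinearMap
    simp only [ContinuousLinearMap.coe_coe, hP.inner_left] at h
    rw [h, htr a]
  -- The coefficient of g(y,Pz) disappears with tr P = 0, and tr g = 2n. The trace of S' thus occurs
  -- with total coefficient -2n - 2(n-1) = -2(2n-1).
  simp only [RiemannianProduct.metricTrace_sub, RiemannianProduct.metricTrace_add,
    RiemannianProduct.metricTrace_const_mul, RiemannianProduct.metricTrace_inner, htrP,
    RiemannianProduct.metricTrace_tensorS₂_end_end hP hD' (hΩ a), hdim] at hsc
  rw [hsc, RiemannianProduct.scalarCurvature]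
  push_cast
  ring
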